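/- Let $G$ be a simple graph on a finite vertex set $V$. A family $\mathcal A=\{A_v : v\in V\}$ of Hermitian operators on $\mathbb C^d$ ($d\ge 1$) with $A_v^2=\mathbb 1$ is said to realise $G$ if $A_u$ and $A_v$ anti-commute when $\{u,v\}$ is an edge of $G$ and commute otherwise. For $\eta\in[0,1]$, the unsharp versions of the $A_v$ are the two-outcome measurements with effects $\mathsf M_v^\eta(\pm)=\tfrac12(\mathbb 1\pm\eta A_v)$; they are jointly measurable if there is a POVM $\mathsf E$ with outcome set $\{\pm1\}^V$ such that $\mathsf M_v^\eta(s)=\sum_{a:\,a_v=s}\mathsf E(a)$ for all $v\in V$ and $s\in\{\pm1\}$. The incompatibility robustness $\eta(G)$ is the maximum of the $\eta\in[0,1]$ for which the measurements $\{\mathsf M_v^\eta\}_{v\in V}$ are jointly measurable, where $\mathcal A$ is a family realising $G$. For $n\ge 1$ let $P_n$ be the path on $n$ vertices. Then $\eta(P_n)$ is well defined: a realising family exists, and the maximum exists and has the same value for every realising family, in every dimension. If $n$ is even, then $$\frac{2}{n+2}\csc\Big(\frac{\pi}{n+2}\Big)\le\eta(P_n)\le\frac1n\cot\Big(\frac{\pi}{2(n+2)}\Big)-\frac1n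 ,$$ and if $n$ is odd, then $$\frac{2}{n+1}\csc\Big(\frac{\pi}{n+1}\Big)\le\eta(P_n)\le\frac1n\csc\Big(\frac{\pi}{2(n+2)}\Big)-\frac1n .$$ Furthermore, $\eta(P_n)\to\frac{2}{\pi}$ as $n\to\infty$. -/

import Mathlib

open scoped ComplexOrder

/-- A positive operator-valued measure on `ℂ^d` with finite outcome set `Ω`. -/
structure IsPOVM {Ω : Type*} [Fintype Ω] {d : ℕ} (M : Ω → Matrix (Fin d) (Fin d) ℂ) : Prop where
  posSemidef : ∀ a, (M a).PosSemidef
  sum_eq_one : ∑ a, M a = 1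

/-- `A` is a family of binary observables (Hermitian, squaring to the identity) on `ℂ^d`, any two
of which commute or anti-commute, and whose anti-commutativity graph is `G`. -/
structure Realises {V : Type*} (G : SimpleGraph V) {d : ℕ}
    (A : V → Matrix (Fin d) (Fin d) ℂ) : Prop where
  isHermitian : ∀ v, (A v).IsHermitian
  mul_self : ∀ v, A v * A v = 1
  adj_iff : ∀ u v, G.Adj u v ↔ A u * A v = -(A v * A u)
  commute : ∀ u v, ¬ G.Adj u v → A u * A v = A v * A u

/-- The effect `(1 + s t A) / 2`, for the outcome `s = ±1`, of the unsharp version, with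
sharpness `t`, of the binary observable `A`. -/
noncomputable def unsharpEffect {d : ℕ} (A : Matrix (Fin d) (Fin d) ℂ) (t : ℝ) (s : ℤˣ) :
    Matrix (Fin d) (Fin d) ℂ :=
  (1 / 2 : ℂ) • (1 + (((s : ℤ) : ℂ) * (t : ℂ)) • A)

/-- The unsharp versions, with sharpness `t`, of the binary observables `A v` are jointly
measurable: a parent POVM with outcomes in `{±1}^V` has all of them as marginals. -/
def JointlyMeasurable {V : Type*} [Fintype V] [DecidableEq V] {d : ℕ}
    (A : V → Matrix (Fin d) (Fin d) ℂ) (t : ℝ) : Prop :=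
  ∃ E : (V → ℤˣ) → Matrix (Fin d) (Fin d) ℂ, IsPOVM E ∧
    ∀ (v : V) (s : ℤˣ), unsharpEffect (A v) t s = ∑ a with a v = s, E a

/-- The sharpness values in `[0, 1]` for which the unsharp versions of the family `A` are
jointly measurable. -/
def jointSharpness {V : Type*} [Fintype V] [DecidableEq V] {d : ℕ}
    (A : V → Matrix (Fin d) (Fin d) ℂ) : Set ℝ :=
  {t | t ∈ Set.Icc (0 : ℝ) 1 ∧ JointlyMeasurable A t}

/-- The incompatibility robustness of a graph: the largest `t ∈ [0, 1]` such that the unsharp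
versions, with sharpness `t`, of binary observables with anti-commutativity graph `G` are jointly
measurable. -/
noncomputable def incompatibilityRobustness {V : Type*} [Fintype V] [DecidableEq V]
    (G : SimpleGraph V) : ℝ :=
  sSup {t | ∃ d : ℕ, 0 < d ∧ ∃ A : V → Matrix (Fin d) (Fin d) ℂ,
    Realises G A ∧ t ∈ jointSharpness A}

open scoped ComplexOrder Kronecker Matrix

lemma jointlyMeasurable_iff {V : Type*} [Fintype V] [DecidableEq V] {d : ℕ}
    (A : V → Matrix (Fin d) (Fin d) ℂ) (t : ℝ) :
    JointlyMeasurable A t ↔ ∃ E : (V → ℤˣ) → Matrix (Fin d) (Fin d) ℂ, IsPOVM E ∧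
      ∀ v, ∑ a, (((a v : ℤˣ) : ℤ) : ℂ) • E a = (t : ℂ) • A v := by
  refine exists_congr fun E => and_congr_right fun hE => forall_congr' fun v => ?_
  constructor
  · intro h
    have key : ∑ s : ℤˣ, ∑ a with a v = s, (((a v : ℤˣ) : ℤ) : ℂ) • E a
        = ∑ a, (((a v : ℤˣ) : ℤ) : ℂ) • E a := Finset.sum_fiberwise _ _ _
    rw [← key]
    have : ∀ s : ℤˣ, ∑ a with a v = s, (((a v : ℤˣ) : ℤ) : ℂ) • E a
        = ((s : ℤ) : ℂ) • unsharpEffect (A v) t s := by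
      intro s
      rw [h s, Finset.smul_sum]
      refine Finset.sum_congr rfl fun a ha => ?_
      rw [(Finset.mem_filter.1 ha).2]
    simp only [this]
    rw [show (Finset.univ : Finset ℤˣ) = {1, -1} from rfl, Finset.sum_pair (by decide)]
    simp only [unsharpEffect]
    ext i j
    simp
    ring
  · intro h s
    have : ∀ a : V → ℤˣ, (if a v = s then E a else 0)
        = (1 / 2 : ℂ) • (E a + ((s : ℤ) : ℂ) • ((((a v : ℤˣ) : ℤ) : ℂ) • E a)) := by
      intro a
      ext i j
      rcases Int.units_eq_one_or s with rfl | rfl <;>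
      rcases Int.units_eq_one_or (a v) with h' | h' <;> rw [h'] <;> simp <;> ring
    rw [Finset.sum_filter]
    simp only [this]
    rw [← Finset.smul_sum, Finset.sum_add_distrib, ← Finset.smul_sum, h, hE.sum_eq_one,
      unsharpEffect, mul_smul]

/-- Commuting Hermitian involutions have a joint spectral measure. -/
lemma exists_joint_spectral_measure {ι : Type*} [Fintype ι] [DecidableEq ι] :
    ∀ {n : ℕ} (K : Fin n → Matrix ι ι ℂ) (_ : ∀ v, (K v).IsHermitian)
      (_ : ∀ v, K v * K v = 1) (_ : ∀ u v, Commute (K u) (K v)),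
    ∃ P : (Fin n → ℤˣ) → Matrix ι ι ℂ, (∀ a, (P a).PosSemidef) ∧ ∑ a, P a = 1 ∧
      (∀ v, ∑ a, (((a v : ℤˣ) : ℤ) : ℂ) • P a = K v) ∧
      ∀ X, (∀ v, Commute X (K v)) → ∀ a, Commute X (P a) := by
  intro n
  induction n with
  | zero =>
    intro K _ _ _
    exact ⟨fun _ => 1, fun _ => .one, by simp, fun v => v.elim0, fun X _ _ => Commute.one_right X⟩
  | succ n ih =>
    intro K hK hK2 hKc
    obtain ⟨P, hP, hP1, hPK, hPc⟩ := ih (fun v => K v.succ) (fun v => hK _) (fun v => hK2 _)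
      (fun u v => hKc _ _)
    let Q : ℤˣ → Matrix ι ι ℂ := fun s => (1 / 2 : ℂ) • (1 + ((s : ℤ) : ℂ) • K 0)
    have hQQ : ∀ s, Q s * Q s = Q s := by
      intro s
      have : ((s : ℤ) : ℂ) * ((s : ℤ) : ℂ) = 1 := by
        rcases Int.units_eq_one_or s with rfl | rfl <;> simp
      simp only [Q, smul_mul_smul_comm, add_mul, mul_add, one_mul, mul_one, hK2, this]
      module
    have hQh : ∀ s, (Q s)ᴴ = Q s := by
      intro s
      simp only [Q, Matrix.conjTranspose_smul, Matrix.conjTranspose_add, (hK 0).eq,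
        Matrix.conjTranspose_one]
      simp
    have hQs : Q 1 + Q (-1) = 1 := by
      simp only [Q]
      push_cast
      module
    have hQd : Q 1 - Q (-1) = K 0 := by
      simp only [Q]
      push_cast
      module
    have hQc : ∀ X, Commute X (K 0) → ∀ s, Commute X (Q s) := fun X hX s =>
      ((Commute.one_right X).add_right (hX.smul_right _)).smul_right _
    have hQP : ∀ s a, Commute (Q s) (P a) := fun s a =>
      hPc _ (fun v => (hQc _ (hKc _ _) s).symm) a
    have hsum : ∀ f : ℤˣ → (Fin n → ℤˣ) → Matrix ι ι ℂ,
        ∑ a : Fin (n + 1) → ℤˣ, f (a 0) (Fin.tail a) = ∑ a, (f 1 a + f (-1) a) := by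
      intro f
      rw [← (Fin.consEquiv (fun _ => ℤˣ)).sum_comp, Fintype.sum_prod_type_right]
      refine Finset.sum_congr rfl fun a _ => ?_
      rw [show (Finset.univ : Finset ℤˣ) = {1, -1} from rfl, Finset.sum_pair (by decide)]
      simp [Fin.consEquiv]
    refine ⟨fun a => Q (a 0) * P (Fin.tail a), fun a => ?_, ?_, fun v => ?_, fun X hX a => ?_⟩
    · have : Q (a 0) * P (Fin.tail a) = (Q (a 0))ᴴ * P (Fin.tail a) * Q (a 0) := by
        rw [hQh, mul_assoc, ← (hQP _ _).eq, ← mul_assoc, hQQ]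
      simp only [this]
      exact (hP _).conjTranspose_mul_mul_same _
    · rw [hsum (fun s a => Q s * P a)]
      simp only [← add_mul, hQs, one_mul, hP1]
    · refine Fin.cases ?_ (fun v => ?_) v
      · rw [hsum (fun s a => ((s : ℤ) : ℂ) • (Q s * P a))]
        have : ∀ a, (((1 : ℤˣ) : ℤ) : ℂ) • (Q 1 * P a) + (((-1 : ℤˣ) : ℤ) : ℂ) • (Q (-1) * P a)
            = K 0 * P a := by
          intro a
          rw [← hQd, sub_mul]
          push_cast
          module
        simp only [this, ← Finset.mul_sum, hP1, mul_one]
      · have := hsum (fun s a => (((a v : ℤˣ) : ℤ) : ℂ) • (Q s * P a))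
        simp only [Fin.tail] at this ⊢
        rw [this]
        simp only [← smul_add, ← add_mul, hQs, one_mul, hPK]
    · exact (hQc X (hX 0) _).mul_right (hPc X (fun v => hX _) _)

/-- If a state on some realisation `B` of the (anti-)commutation relations of `A` gives all the
observables the expectation `t`, then `A` is jointly measurable at sharpness `t`. -/
lemma jointlyMeasurable_of_state {n d : ℕ} {ι : Type*} [Fintype ι] [DecidableEq ι]
    {A : Fin n → Matrix (Fin d) (Fin d) ℂ} {B : Fin n → Matrix ι ι ℂ}
    (hA : ∀ v, (A v).IsHermitian) (hA2 : ∀ v, A v * A v = 1)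
    (hB : ∀ v, (B v).IsHermitian) (hB2 : ∀ v, B v * B v = 1)
    (hAB : ∀ u v, (A u * A v = A v * A u ∧ B u * B v = B v * B u) ∨
      (A u * A v = -(A v * A u) ∧ B u * B v = -(B v * B u)))
    {ρ : Matrix ι ι ℂ} (hρ : ρ.PosSemidef) (hρ1 : ρ.trace = 1) {t : ℝ}
    (ht : ∀ v, (B v * ρ).trace = t) : JointlyMeasurable A t := by
  obtain ⟨P, hP, hP1, hPK, -⟩ := exists_joint_spectral_measure (fun v => A v ⊗ₖ B v)
    (fun v => by rw [Matrix.IsHermitian, Matrix.conjTranspose_kronecker, hA, hB])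
    (fun v => by rw [← Matrix.mul_kronecker_mul, hA2, hB2, Matrix.one_kronecker_one])
    (fun u v => by
      rw [Commute, SemiconjBy, ← Matrix.mul_kronecker_mul, ← Matrix.mul_kronecker_mul]
      rcases hAB u v with ⟨h1, h2⟩ | ⟨h1, h2⟩
      · rw [h1, h2]
      · rw [h1, h2]
        ext i j
        simp [Matrix.kroneckerMap_apply])
  obtain ⟨m, w, hw⟩ := Matrix.posSemidef_iff_eq_sum_vecMulVec.1 hρ
  let T : Matrix (Fin d × ι) (Fin d × ι) ℂ →ₗ[ℂ] Matrix (Fin d) (Fin d) ℂ :=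
    { toFun := fun X => Matrix.of fun i j => ∑ p, ∑ q, X (i, p) (j, q) * ρ q p
      map_add' := fun X Y => by
        ext i j
        simp [add_mul, Finset.sum_add_distrib]
      map_smul' := fun c X => by
        ext i j
        simp [Finset.mul_sum, mul_assoc] }
  have hT : ∀ X Y, T (X ⊗ₖ Y) = (Y * ρ).trace • X := by
    intro X Y
    ext i j
    simp only [T, LinearMap.coe_mk, AddHom.coe_mk, Matrix.of_apply, Matrix.kroneckerMap_apply,
      Matrix.smul_apply, Matrix.trace, Matrix.diag, Matrix.mul_apply, smul_eq_mul, Finset.sum_mul]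
    refine Finset.sum_congr rfl fun p _ => Finset.sum_congr rfl fun q _ => by ring
  have hTpos : ∀ X : Matrix (Fin d × ι) (Fin d × ι) ℂ, X.PosSemidef → (T X).PosSemidef := by
    intro X hX
    let N : Fin m → Matrix (Fin d × ι) (Fin d) ℂ :=
      fun r => Matrix.of fun x j => if x.1 = j then w r x.2 else 0
    have : T X = ∑ r, (N r)ᴴ * X * N r := by
      ext i j
      simp only [T, LinearMap.coe_mk, AddHom.coe_mk, Matrix.of_apply, Matrix.sum_apply,
        Matrix.mul_apply, N, Matrix.conjTranspose_apply, Fintype.sum_prod_type, hw,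
        Matrix.vecMulVec_apply, Pi.star_apply, apply_ite star, star_zero, ite_mul, mul_ite,
        mul_zero, zero_mul, Finset.sum_ite_eq', Finset.sum_ite_irrel, Finset.sum_const_zero,
        Finset.mem_univ, if_true, Finset.sum_mul, Finset.mul_sum]
      rw [Finset.sum_comm]
      simp_rw [Finset.sum_comm (s := (Finset.univ : Finset (Fin m))) (t := (Finset.univ : Finset ι))]
      refine Finset.sum_congr rfl fun p _ => Finset.sum_congr rfl fun q _ =>
        Finset.sum_congr rfl fun r _ => by ring
    rw [this]
    exact Matrix.posSemidef_sum _ fun r _ => hX.conjTranspose_mul_mul_same _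
  refine (jointlyMeasurable_iff A t).2 ⟨fun a => T (P a), ⟨fun a => hTpos _ (hP a), ?_⟩,
    fun v => ?_⟩
  · rw [← map_sum, hP1, ← Matrix.one_kronecker_one, hT, one_mul, hρ1, one_smul]
  · simp only [← map_smul, ← map_sum, hPK, hT, ht]

/-- A parent measurement of `A` gives a state on a realisation of the (anti-)commutation
relations of `A` for which all the observables have the expectation `t`. -/
lemma JointlyMeasurable.exists_state {n d : ℕ} (hd : 0 < d)
    {A : Fin n → Matrix (Fin d) (Fin d) ℂ} (hA : ∀ v, (A v).IsHermitian)
    (hA2 : ∀ v, A v * A v = 1) {t : ℝ} (h : JointlyMeasurable A t) :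
    ∃ (B : Fin n → Matrix (Fin d × (Fin n → ℤˣ)) (Fin d × (Fin n → ℤˣ)) ℂ)
      (ρ : Matrix (Fin d × (Fin n → ℤˣ)) (Fin d × (Fin n → ℤˣ)) ℂ),
      (∀ v, (B v).IsHermitian) ∧ (∀ v, B v * B v = 1) ∧
      (∀ u v, A u * A v = A v * A u → B u * B v = B v * B u) ∧
      (∀ u v, A u * A v = -(A v * A u) → B u * B v = -(B v * B u)) ∧
      ρ.PosSemidef ∧ ρ.trace = 1 ∧ ∀ v, (B v * ρ).trace = t := by
  obtain ⟨E, hE, hEA⟩ := (jointlyMeasurable_iff A t).1 h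
  have hd' : (d : ℂ) ≠ 0 := by exact_mod_cast hd.ne'
  refine ⟨fun v => Matrix.blockDiagonal fun a => (((a v : ℤˣ) : ℤ) : ℂ) • A v,
    (1 / d : ℂ) • Matrix.blockDiagonal E, fun v => ?_, fun v => ?_, fun u v huv => ?_,
    fun u v huv => ?_, ?_, ?_, fun v => ?_⟩
  · rw [Matrix.IsHermitian, Matrix.blockDiagonal_conjTranspose]
    simp [Matrix.conjTranspose_smul, (hA v).eq]
  · rw [← Matrix.blockDiagonal_mul, ← Matrix.blockDiagonal_one]
    congr 1
    ext1 a
    simp only [smul_mul_smul_comm, hA2]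
    rcases Int.units_eq_one_or (a v) with h | h <;> simp [h]
  · rw [← Matrix.blockDiagonal_mul, ← Matrix.blockDiagonal_mul]
    simp only [smul_mul_smul_comm, huv, mul_comm]
  · rw [← Matrix.blockDiagonal_mul, ← Matrix.blockDiagonal_mul, ← Matrix.blockDiagonal_neg]
    congr 1
    ext1 a
    simp only [smul_mul_smul_comm, huv, mul_comm, Pi.neg_apply, smul_neg]
  · refine Matrix.PosSemidef.smul ?_ (by positivity)
    refine .of_dotProduct_mulVec_nonneg ?_ fun x => ?_
    · rw [Matrix.IsHermitian, Matrix.blockDiagonal_conjTranspose]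
      simp only [(hE.posSemidef _).1.eq]
    · have : star x ⬝ᵥ (Matrix.blockDiagonal E).mulVec x
          = ∑ a, star (fun i => x (i, a)) ⬝ᵥ (E a).mulVec fun i => x (i, a) := by
        simp [dotProduct, Matrix.mulVec, Fintype.sum_prod_type_right, Matrix.blockDiagonal_apply]
      rw [this]
      exact Finset.sum_nonneg fun a _ => (hE.posSemidef a).dotProduct_mulVec_nonneg _
  · rw [Matrix.trace_smul, Matrix.trace_blockDiagonal, ← Matrix.trace_sum, hE.sum_eq_one]
    simp [hd']
  · rw [Matrix.mul_smul, ← Matrix.blockDiagonal_mul, Matrix.trace_smul,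
      Matrix.trace_blockDiagonal, ← Matrix.trace_sum]
    simp only [Matrix.smul_mul, ← Matrix.mul_smul, ← Matrix.mul_sum, hEA]
    simp only [Matrix.mul_smul, hA2, Matrix.trace_smul, Matrix.trace_one, Fintype.card_fin,
      smul_eq_mul]
    field_simp

lemma Matrix.PosSemidef.two_mul_norm_apply_le {ι : Type*} [Finite ι] {M : Matrix ι ι ℂ}
    (hM : M.PosSemidef) (i j : ι) : 2 * ‖M i j‖ ≤ (M i i).re + (M j j).re := by
  obtain ⟨m, w, rfl⟩ := Matrix.posSemidef_iff_eq_sum_vecMulVec.1 hM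
  simp only [Matrix.sum_apply, Matrix.vecMulVec_apply, Pi.star_apply, Complex.re_sum]
  have hre : ∀ z : ℂ, (z * star z).re = ‖z‖ ^ 2 := fun z => by
    rw [Complex.star_def, Complex.mul_conj, Complex.normSq_eq_norm_sq, Complex.ofReal_re]
  rw [← Finset.sum_add_distrib]
  refine (mul_le_mul_of_nonneg_left (norm_sum_le _ _) zero_le_two).trans ?_
  rw [Finset.mul_sum]
  refine Finset.sum_le_sum fun r _ => ?_
  rw [hre, hre, norm_mul, norm_star]
  nlinarith [sq_nonneg (‖w r i‖ - ‖w r j‖)]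

lemma IsPOVM.norm_apply_le_one {Ω : Type*} [Fintype Ω] {d : ℕ}
    {E : Ω → Matrix (Fin d) (Fin d) ℂ} (hE : IsPOVM E) (a : Ω) (i j : Fin d) :
    ‖E a i j‖ ≤ 1 := by
  have hdiag : ∀ i, (E a i i).re ≤ 1 := by
    intro i
    have h1 : ∑ b, (E b i i).re = 1 := by
      rw [← Complex.re_sum, ← Matrix.sum_apply, hE.sum_eq_one]
      simp
    rw [← h1]
    exact Finset.single_le_sum (f := fun b => (E b i i).re)
      (fun b _ => (Complex.nonneg_iff.1 (hE.posSemidef b).diag_nonneg).1) (Finset.mem_univ a)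
  linarith [(hE.posSemidef a).two_mul_norm_apply_le i j, hdiag i, hdiag j]

lemma isClosed_posSemidef {ι : Type*} [Fintype ι] :
    IsClosed {M : Matrix ι ι ℂ | M.PosSemidef} := by
  simp only [Matrix.posSemidef_iff_dotProduct_mulVec, Matrix.IsHermitian, Set.ofPred_and,
    Set.ofPred_forall]
  refine (isClosed_eq (by fun_prop) continuous_id).inter (isClosed_iInter fun x => ?_)
  exact isClosed_Ici.preimage (f := fun M : Matrix ι ι ℂ => star x ⬝ᵥ M *ᵥ x) (by fun_prop)

lemma isCompact_jointSharpness {V : Type*} [Fintype V] [DecidableEq V] {d : ℕ}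
    (A : V → Matrix (Fin d) (Fin d) ℂ) : IsCompact (jointSharpness A) := by
  let S : Set (ℝ × ((V → ℤˣ) → Matrix (Fin d) (Fin d) ℂ)) := {p | p.1 ∈ Set.Icc (0 : ℝ) 1 ∧
    ((∀ a, (p.2 a).PosSemidef) ∧ ∑ a, p.2 a = 1) ∧
      ∀ v, ∑ a, (((a v : ℤˣ) : ℤ) : ℂ) • p.2 a = (p.1 : ℂ) • A v}
  have himage : jointSharpness A = Prod.fst '' S := by
    ext t
    simp only [jointSharpness, jointlyMeasurable_iff, Set.mem_ofPred_eq, Set.mem_image, S,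
      Prod.exists, exists_and_right, exists_eq_right]
    constructor
    · rintro ⟨ht, E, hE, h⟩
      exact ⟨E, ht, ⟨hE.1, hE.2⟩, h⟩
    · rintro ⟨E, ht, hE, h⟩
      exact ⟨ht, E, ⟨hE.1, hE.2⟩, h⟩
  rw [himage]
  refine IsCompact.image ?_ continuous_fst
  have hbox : IsCompact {M : Matrix (Fin d) (Fin d) ℂ | ∀ i j, ‖M i j‖ ≤ 1} := by
    have h : IsCompact {M : Fin d → Fin d → ℂ | ∀ i j, ‖M i j‖ ≤ 1} := by
      have h' : IsCompact (Set.univ.pi fun _ : Fin d => Set.univ.pi fun _ : Fin d =>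
          Metric.closedBall (0 : ℂ) 1) :=
        isCompact_univ_pi fun _ => isCompact_univ_pi fun _ => isCompact_closedBall 0 1
      simpa [Set.pi] using h'
    exact h
  have hclosed : IsClosed S := by
    simp only [S, Set.ofPred_and, Set.ofPred_forall]
    refine (isClosed_Icc.preimage continuous_fst).inter
      (((isClosed_iInter fun a => ?_).inter ?_).inter (isClosed_iInter fun v => ?_))
    · exact IsClosed.preimage (t := {M : Matrix (Fin d) (Fin d) ℂ | M.PosSemidef})
        (f := fun p : ℝ × ((V → ℤˣ) → Matrix (Fin d) (Fin d) ℂ) => p.2 a)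
        ((continuous_apply a).comp continuous_snd) isClosed_posSemidef
    · exact isClosed_eq (by fun_prop) continuous_const
    · exact isClosed_eq (by fun_prop)
        ((Complex.continuous_ofReal.comp continuous_fst).smul continuous_const)
  have hprod := (isCompact_Icc (a := (0 : ℝ)) (b := 1)).prod
    (isCompact_univ_pi fun _ : V → ℤˣ => hbox)
  refine hprod.of_isClosed_subset hclosed ?_
  rintro ⟨t, E⟩ ⟨ht, hE, -⟩
  exact ⟨ht, fun a _ i j => IsPOVM.norm_apply_le_one ⟨hE.1, hE.2⟩ a i j⟩

lemma mul_ne_neg_of_mul_self_eq_one {V : Type*} {d : ℕ} (hd : 0 < d)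
    {A : V → Matrix (Fin d) (Fin d) ℂ} (hA : ∀ v, A v * A v = 1) {u v : V}
    (h : A u * A v = A v * A u) : A u * A v ≠ -(A v * A u) := by
  intro h'
  have : NeZero d := ⟨hd.ne'⟩
  have h0 : A u * A v = 0 := by
    rw [← h] at h'
    have h2 : (2 : ℂ) • (A u * A v) = 0 := by
      rw [two_smul]
      exact add_eq_zero_iff_eq_neg.2 h'
    exact (smul_eq_zero.1 h2).resolve_left two_ne_zero
  have h1 : A u * A v * A v = 0 := by rw [h0, zero_mul]
  rw [mul_assoc, hA, mul_one] at h1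
  have h2 := hA u
  rw [h1, zero_mul] at h2
  exact zero_ne_one h2

/-- Joint measurability does not depend on the realisation. -/
lemma JointlyMeasurable.of_realises {n d d' : ℕ} {G : SimpleGraph (Fin n)} (hd : 0 < d)
    {A : Fin n → Matrix (Fin d) (Fin d) ℂ} {A' : Fin n → Matrix (Fin d') (Fin d') ℂ}
    (hA : Realises G A) (hA' : Realises G A') {t : ℝ} (h : JointlyMeasurable A t) :
    JointlyMeasurable A' t := by
  obtain ⟨B, ρ, hB, hB2, hBc, hBa, hρ, hρ1, ht⟩ := h.exists_state hd hA.isHermitian hA.mul_self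
  refine jointlyMeasurable_of_state hA'.isHermitian hA'.mul_self hB hB2 (fun u v => ?_) hρ hρ1 ht
  by_cases huv : G.Adj u v
  · exact Or.inr ⟨(hA'.adj_iff u v).1 huv, hBa u v ((hA.adj_iff u v).1 huv)⟩
  · exact Or.inl ⟨hA'.commute u v huv, hBc u v (hA.commute u v huv)⟩

lemma jointSharpness_eq_of_realises {n d d' : ℕ} {G : SimpleGraph (Fin n)} (hd : 0 < d)
    (hd' : 0 < d') {A : Fin n → Matrix (Fin d) (Fin d) ℂ}
    {A' : Fin n → Matrix (Fin d') (Fin d') ℂ} (hA : Realises G A) (hA' : Realises G A') :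
    jointSharpness A = jointSharpness A' := by
  ext t
  exact and_congr_right fun _ => ⟨fun h => h.of_realises hd hA hA', fun h => h.of_realises hd' hA' hA⟩

lemma zero_mem_jointSharpness {V : Type*} [Fintype V] [DecidableEq V] {d : ℕ}
    (A : V → Matrix (Fin d) (Fin d) ℂ) : (0 : ℝ) ∈ jointSharpness A := by
  refine ⟨by simp, (jointlyMeasurable_iff A 0).2
    ⟨fun _ => (1 / Fintype.card (V → ℤˣ) : ℂ) • 1, ⟨fun _ => ?_, ?_⟩, fun v => ?_⟩⟩
  · exact Matrix.PosSemidef.one.smul (by positivity)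
  · rw [Finset.sum_const, Finset.card_univ, ← Nat.cast_smul_eq_nsmul ℂ, smul_smul,
      mul_one_div_cancel (by exact_mod_cast Fintype.card_ne_zero), one_smul]
  · rw [← Finset.sum_smul, Complex.ofReal_zero, zero_smul]
    have : ∑ a : V → ℤˣ, (((a v : ℤˣ) : ℤ) : ℂ) = 0 := by
      have h := Equiv.sum_comp (Equiv.neg (V → ℤˣ)) fun a : V → ℤˣ => (((a v : ℤˣ) : ℤ) : ℂ)
      simp only [Equiv.neg_apply, Pi.neg_apply, Units.val_neg, Int.cast_neg,
        Finset.sum_neg_distrib] at h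
      exact self_eq_neg.1 h.symm
    rw [this, zero_smul]

lemma incompatibilityRobustness_eq_sSup {n d : ℕ} {G : SimpleGraph (Fin n)} (hd : 0 < d)
    {A : Fin n → Matrix (Fin d) (Fin d) ℂ} (hA : Realises G A) :
    incompatibilityRobustness G = sSup (jointSharpness A) := by
  refine congrArg sSup (Set.ext fun t => ⟨?_, fun h => ⟨d, hd, A, hA, h⟩⟩)
  rintro ⟨d', hd', A', hA', h⟩
  exact (jointSharpness_eq_of_realises hd hd' hA hA').symm ▸ h

lemma isGreatest_incompatibilityRobustness {n d : ℕ} {G : SimpleGraph (Fin n)} (hd : 0 < d)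
    {A : Fin n → Matrix (Fin d) (Fin d) ℂ} (hA : Realises G A) :
    IsGreatest (jointSharpness A) (incompatibilityRobustness G) := by
  rw [incompatibilityRobustness_eq_sSup hd hA]
  exact (isCompact_jointSharpness A).isGreatest_sSup ⟨0, zero_mem_jointSharpness A⟩

/-- Pairwise anti-commuting Hermitian involutions. -/
structure IsMajorana {ι κ : Type*} [Fintype ι] [DecidableEq ι] (γ : κ → Matrix ι ι ℂ) : Prop where
  isHermitian : ∀ j, (γ j).IsHermitian
  mul_self : ∀ j, γ j * γ j = 1
  anticomm : ∀ i j, i ≠ j → γ i * γ j = -(γ j * γ i)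

lemma exists_isMajorana_fintype (m : ℕ) : ∃ (ι : Type) (_ : Fintype ι) (_ : DecidableEq ι)
    (_ : Nonempty ι) (γ : Fin m → Matrix ι ι ℂ), IsMajorana γ := by
  induction m with
  | zero => exact ⟨Unit, inferInstance, inferInstance, inferInstance, fun j => j.elim0,
      fun j => j.elim0, fun j => j.elim0, fun j => j.elim0⟩
  | succ m ih =>
    obtain ⟨ι, _, _, _, γ, hγ⟩ := ih
    refine ⟨ι ⊕ ι, inferInstance, inferInstance, inferInstance,
      Fin.cons (Matrix.fromBlocks 1 0 0 (-1)) (fun j => Matrix.fromBlocks 0 (γ j) (γ j) 0),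
      fun j => ?_, fun j => ?_, fun i j => ?_⟩
    · refine Fin.cases ?_ (fun j => ?_) j
      · simp [Matrix.IsHermitian, Matrix.fromBlocks_conjTranspose]
      · simp [Matrix.IsHermitian, Matrix.fromBlocks_conjTranspose, (hγ.isHermitian j).eq]
    · refine Fin.cases ?_ (fun j => ?_) j
      · simp [Matrix.fromBlocks_multiply]
      · simp [Matrix.fromBlocks_multiply, hγ.mul_self]
    · refine Fin.cases ?_ (fun i => ?_) i <;> refine Fin.cases ?_ (fun j => ?_) j
      · simp
      · simp [Matrix.fromBlocks_multiply, Matrix.fromBlocks_neg]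
      · simp [Matrix.fromBlocks_multiply, Matrix.fromBlocks_neg]
      · intro hij
        simp [Matrix.fromBlocks_multiply, Matrix.fromBlocks_neg,
          hγ.anticomm i j (by simpa using hij)]

lemma exists_isMajorana (m : ℕ) :
    ∃ d : ℕ, 0 < d ∧ ∃ γ : Fin m → Matrix (Fin d) (Fin d) ℂ, IsMajorana γ := by
  obtain ⟨ι, _, _, _, γ, hγ⟩ := exists_isMajorana_fintype m
  let e := Matrix.reindexAlgEquiv ℂ ℂ (Fintype.equivFin ι)
  refine ⟨Fintype.card ι, Fintype.card_pos, fun j => e (γ j), fun j => ?_, fun j => ?_,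
    fun i j hij => ?_⟩
  · exact (hγ.isHermitian j).submatrix _
  · rw [← map_mul, hγ.mul_self, map_one]
  · rw [← map_mul, ← map_mul, hγ.anticomm i j hij, map_neg]

lemma IsMajorana.comp {ι κ κ' : Type*} [Fintype ι] [DecidableEq ι] {γ : κ → Matrix ι ι ℂ}
    (hγ : IsMajorana γ) {f : κ' → κ} (hf : Function.Injective f) : IsMajorana (γ ∘ f) :=
  ⟨fun _ => hγ.1 _, fun _ => hγ.2 _, fun _ _ hij => hγ.3 _ _ (hf.ne hij)⟩

/-- The nearest-neighbour products `-i γ_v γ_{v+1}`. -/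
noncomputable def neighbourProduct {ι : Type*} [Fintype ι] {n : ℕ}
    (γ : Fin (n + 1) → Matrix ι ι ℂ) (v : Fin n) : Matrix ι ι ℂ :=
  (-Complex.I) • (γ v.castSucc * γ v.succ)

section
variable {ι : Type*} [Fintype ι] [DecidableEq ι] {n : ℕ} {γ : Fin (n + 1) → Matrix ι ι ℂ}

lemma IsMajorana.neighbourProduct_isHermitian (hγ : IsMajorana γ) (v : Fin n) :
    (neighbourProduct γ v).IsHermitian := by
  rw [Matrix.IsHermitian, neighbourProduct, Matrix.conjTranspose_smul, Matrix.conjTranspose_mul,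
    (hγ.isHermitian _).eq, (hγ.isHermitian _).eq, hγ.anticomm _ _ (Fin.castSucc_lt_succ).ne']
  simp

lemma IsMajorana.mul_mul_mul_comm_of_ne (hγ : IsMajorana γ) {a b c e : Fin (n + 1)} (hac : a ≠ c)
    (hbc : b ≠ c) (hae : a ≠ e) (hbe : b ≠ e) :
    γ a * γ b * (γ c * γ e) = γ c * γ e * (γ a * γ b) := by
  have h : ∀ x, a ≠ x → b ≠ x → Commute (γ a * γ b) (γ x) := fun x ha hb => by
    rw [Commute, SemiconjBy, mul_assoc, hγ.anticomm b x hb, mul_neg, ← mul_assoc,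
      hγ.anticomm a x ha, neg_mul, neg_neg, mul_assoc]
  exact (h c hac hbc).mul_right (h e hae hbe)

lemma IsMajorana.mul_mul_mul_anticomm (hγ : IsMajorana γ) {a b c : Fin (n + 1)} (hab : a ≠ b)
    (hbc : b ≠ c) (hac : a ≠ c) : γ a * γ b * (γ b * γ c) = -(γ b * γ c * (γ a * γ b)) := by
  have h1 : γ a * γ b * (γ b * γ c) = γ a * γ c := by
    rw [mul_assoc, ← mul_assoc (γ b), hγ.mul_self, one_mul]
  have h2 : γ b * γ c * (γ a * γ b) = γ c * γ a := by
    rw [hγ.anticomm b c hbc, hγ.anticomm a b hab, neg_mul_neg, mul_assoc, ← mul_assoc (γ b),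
      hγ.mul_self, one_mul]
  rw [h1, h2, hγ.anticomm a c hac]

lemma IsMajorana.neighbourProduct_anticomm (hγ : IsMajorana γ) {u v : Fin n}
    (h : (SimpleGraph.pathGraph n).Adj u v) :
    neighbourProduct γ u * neighbourProduct γ v
      = -(neighbourProduct γ v * neighbourProduct γ u) := by
  wlog huv : u.val + 1 = v.val generalizing u v
  · rw [this h.symm ((SimpleGraph.pathGraph_adj.1 h).resolve_left huv), neg_neg]
  have : v.castSucc = u.succ := by ext; simp [huv]
  simp only [neighbourProduct, smul_mul_smul_comm, this]
  rw [hγ.mul_mul_mul_anticomm, smul_neg, mul_comm] <;> simp [Fin.ext_iff] <;> omega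

lemma IsMajorana.neighbourProduct_commute (hγ : IsMajorana γ) {u v : Fin n}
    (h : ¬ (SimpleGraph.pathGraph n).Adj u v) :
    neighbourProduct γ u * neighbourProduct γ v = neighbourProduct γ v * neighbourProduct γ u := by
  rcases eq_or_ne u v with rfl | huv
  · rfl
  rw [SimpleGraph.pathGraph_adj] at h
  rw [ne_eq, Fin.ext_iff] at huv
  simp only [neighbourProduct, smul_mul_smul_comm]
  rw [hγ.mul_mul_mul_comm_of_ne] <;> simp [Fin.ext_iff] <;> omega

lemma IsMajorana.neighbourProduct_mul_self (hγ : IsMajorana γ) (v : Fin n) :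
    neighbourProduct γ v * neighbourProduct γ v = 1 := by
  have hne : v.castSucc ≠ v.succ := (Fin.castSucc_lt_succ).ne
  rw [neighbourProduct, smul_mul_smul_comm, neg_mul_neg, Complex.I_mul_I, mul_assoc, ← mul_assoc (γ v.succ),
    hγ.anticomm _ _ hne.symm, neg_mul, mul_assoc, hγ.mul_self, mul_one, mul_neg, hγ.mul_self]
  simp

end

lemma IsMajorana.realises {d : ℕ} (hd : 0 < d) {n : ℕ}
    {γ : Fin (n + 1) → Matrix (Fin d) (Fin d) ℂ} (hγ : IsMajorana γ) :
    Realises (SimpleGraph.pathGraph n) (neighbourProduct γ) where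
  isHermitian := hγ.neighbourProduct_isHermitian
  mul_self := hγ.neighbourProduct_mul_self
  adj_iff u v := ⟨fun h => hγ.neighbourProduct_anticomm h, fun h => by
    by_contra h'
    exact mul_ne_neg_of_mul_self_eq_one hd hγ.neighbourProduct_mul_self
      (hγ.neighbourProduct_commute h') h⟩
  commute u v h := hγ.neighbourProduct_commute h

lemma exists_realises_pathGraph (n : ℕ) : ∃ d : ℕ, 0 < d ∧
    ∃ A : Fin n → Matrix (Fin d) (Fin d) ℂ, Realises (SimpleGraph.pathGraph n) A := by
  obtain ⟨d, hd, γ, hγ⟩ := exists_isMajorana (n + 1)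
  exact ⟨d, hd, _, hγ.realises hd⟩

lemma exists_ne_zero_mulVec_eq_zero {ι : Type*} [Fintype ι] [Nonempty ι] (c : ℕ → Matrix ι ι ℂ) :
    ∀ r : ℕ, (∀ i < r, ∀ j < r, c i * c j = -(c j * c i)) →
      ∃ ψ : ι → ℂ, ψ ≠ 0 ∧ ∀ k < r, c k *ᵥ ψ = 0 := by
  intro r
  induction r with
  | zero => exact fun _ => ⟨fun _ => 1, fun h => one_ne_zero (congrFun h (Classical.arbitrary ι)),
      by simp⟩
  | succ r ih =>
    intro h
    obtain ⟨ψ, hψ, hc⟩ := ih fun i hi j hj => h i (by omega) j (by omega)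
    by_cases h0 : c r *ᵥ ψ = 0
    · refine ⟨ψ, hψ, fun k hk => ?_⟩
      rcases Nat.lt_succ_iff_lt_or_eq.1 hk with hk | rfl
      exacts [hc k hk, h0]
    · refine ⟨c r *ᵥ ψ, h0, fun k hk => ?_⟩
      rcases Nat.lt_succ_iff_lt_or_eq.1 hk with hk' | rfl
      · rw [Matrix.mulVec_mulVec, h k hk r (by omega), Matrix.neg_mulVec, ← Matrix.mulVec_mulVec,
          hc k hk', Matrix.mulVec_zero, neg_zero]
      · have hsq : c k * c k = 0 := by
          have h2 : (2 : ℂ) • (c k * c k) = 0 := by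
            rw [two_smul]
            exact add_eq_zero_iff_eq_neg.2 (h k (by omega) k (by omega))
          exact (smul_eq_zero.1 h2).resolve_left two_ne_zero
        rw [Matrix.mulVec_mulVec, hsq, Matrix.zero_mulVec]

/-- The antiperiodic momenta on a ring of `2 r` sites. -/
noncomputable def ringMomentum (r k : ℕ) : ℝ := (2 * k + 1) * Real.pi / (2 * r)

lemma sum_cos_ringMomentum {r : ℕ} (hr : 0 < r) {p : ℤ} (hp : p ≠ 0) (hp' : |p| < 2 * r) :
    ∑ k ∈ Finset.range r, Real.cos (p * ringMomentum r k) = 0 := by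
  have hr' : (r : ℝ) ≠ 0 := by positivity
  have hs : Real.sin (p * Real.pi / (2 * r)) ≠ 0 := by
    rw [Ne, Real.sin_eq_zero_iff]
    rintro ⟨q, hq⟩
    have h1 : (q * (2 * r) : ℝ) = p := by
      have := Real.pi_ne_zero
      field_simp at hq
      linarith
    have h2 : p = 2 * r * q := by
      have : q * (2 * r) = p := by exact_mod_cast h1
      linarith
    have hd : (2 * r : ℤ) ∣ p := ⟨q, h2⟩
    exact hp (Int.eq_zero_of_abs_lt_dvd hd hp')
  have h := Real.sin_mul_sum_cos r (p * Real.pi / r) (p * Real.pi / (2 * r))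
  have e1 : (p * Real.pi / r) / 2 = p * Real.pi / (2 * r) := by field_simp
  have e2 : (r : ℝ) * (p * Real.pi / r) / 2 = p * Real.pi / 2 := by field_simp
  have e3 : ((r : ℝ) - 1) * (p * Real.pi / r) / 2 + p * Real.pi / (2 * r) = p * Real.pi / 2 := by
    field_simp
    ring
  have e4 : Real.sin (p * Real.pi / 2) * Real.cos (p * Real.pi / 2) = 0 := by
    have := Real.sin_two_mul (p * Real.pi / 2)
    rw [show 2 * (p * Real.pi / 2) = p * Real.pi by ring, Real.sin_int_mul_pi] at this
    linarith
  rw [e1, e2, e3, e4] at h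
  rw [← (mul_eq_zero.1 h).resolve_left hs]
  refine Finset.sum_congr rfl fun k _ => congrArg _ ?_
  rw [ringMomentum]
  field_simp

lemma sum_sin_ringMomentum {r : ℕ} (hr : 0 < r) :
    ∑ k ∈ Finset.range r, Real.sin (ringMomentum r k) = 1 / Real.sin (Real.pi / (2 * r)) := by
  have hr' : (1 : ℝ) ≤ r := by exact_mod_cast hr
  have hs : 0 < Real.sin (Real.pi / (2 * r)) := by
    refine Real.sin_pos_of_pos_of_lt_pi (by positivity) ?_
    exact div_lt_self Real.pi_pos (by linarith)
  have h := Real.sin_mul_sum_sin r (Real.pi / r) (Real.pi / (2 * r))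
  have e1 : (Real.pi / r) / 2 = Real.pi / (2 * r) := by field_simp
  have e2 : (r : ℝ) * (Real.pi / r) / 2 = Real.pi / 2 := by field_simp
  have e3 : ((r : ℝ) - 1) * (Real.pi / r) / 2 + Real.pi / (2 * r) = Real.pi / 2 := by
    field_simp
    ring
  rw [e1, e2, e3, Real.sin_pi_div_two, mul_one] at h
  rw [eq_div_iff hs.ne', mul_comm, ← h]
  refine congrArg _ (Finset.sum_congr rfl fun k _ => congrArg _ ?_)
  rw [ringMomentum]
  field_simp

lemma sum_exp_ringMomentum {r : ℕ} (hr : 0 < r) :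
    ∑ k ∈ Finset.range r, Complex.exp (ringMomentum r k * Complex.I)
      = Complex.I / Real.sin (Real.pi / (2 * r)) := by
  have hc := sum_cos_ringMomentum hr (p := 1) one_ne_zero (by rw [abs_one]; omega)
  simp only [Int.cast_one, one_mul] at hc
  simp only [Complex.exp_mul_I, Finset.sum_add_distrib, ← Finset.sum_mul, ← Complex.ofReal_cos,
    ← Complex.ofReal_sin, ← Complex.ofReal_sum, hc, sum_sin_ringMomentum hr]
  push_cast
  ring

lemma sum_exp_add_exp_ringMomentum {r : ℕ} (hr : 0 < r) (i j : Fin (2 * r)) :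
    ∑ k ∈ Finset.range r, (Complex.exp (ringMomentum r k * (i - j) * Complex.I)
      + Complex.exp (-(ringMomentum r k * (i - j) * Complex.I))) = if i = j then 2 * (r : ℂ) else 0 := by
  split_ifs with hij
  · subst hij
    simp
    ring
  · have h := sum_cos_ringMomentum hr (p := (i : ℤ) - j) (by omega) (by rw [abs_lt]; omega)
    have : ∀ k, Complex.exp (ringMomentum r k * (i - j) * Complex.I)
      + Complex.exp (-(ringMomentum r k * (i - j) * Complex.I))
        = ((2 * Real.cos (((i : ℤ) - j : ℤ) * ringMomentum r k) : ℝ) : ℂ) := by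
      intro k
      push_cast
      rw [Complex.two_cos, ← neg_mul]
      ring_nf
    simp only [this, ← Complex.ofReal_sum, ← Finset.mul_sum, h]
    simp

/-- The annihilation operator of the antiperiodic mode `k` on a ring of Majorana operators. -/
noncomputable def ringMode {ι : Type*} [Fintype ι] {r : ℕ} (γ : Fin (2 * r) → Matrix ι ι ℂ)
    (k : ℕ) : Matrix ι ι ℂ :=
  ∑ j : Fin (2 * r), Complex.exp (ringMomentum r k * j * Complex.I) • γ j

lemma IsMajorana.sum_smul_anticomm {ι κ : Type*} [Fintype ι] [DecidableEq ι] [Fintype κ]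
    {γ : κ → Matrix ι ι ℂ} (hγ : IsMajorana γ) (x y : κ → ℂ) :
    (∑ i, x i • γ i) * (∑ j, y j • γ j) + (∑ j, y j • γ j) * (∑ i, x i • γ i)
      = (2 * ∑ i, x i * y i) • (1 : Matrix ι ι ℂ) := by
  classical
  simp only [Finset.sum_mul_sum, smul_mul_smul_comm]
  rw [Finset.sum_comm (f := fun i j => (y i * x j) • (γ i * γ j)), ← Finset.sum_add_distrib,
    Finset.mul_sum, Finset.sum_smul]
  refine Finset.sum_congr rfl fun i _ => ?_
  rw [← Finset.sum_add_distrib, Finset.sum_eq_single i]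
  · rw [hγ.mul_self]
    module
  · intro j _ hij
    rw [hγ.anticomm i j hij.symm]
    module
  · simp

lemma IsMajorana.ringMode_anticomm {ι : Type*} [Fintype ι] [DecidableEq ι] {r : ℕ}
    {γ : Fin (2 * r) → Matrix ι ι ℂ} (hγ : IsMajorana γ) {k l : ℕ} (hk : k < r) (hl : l < r) :
    ringMode γ k * ringMode γ l = -(ringMode γ l * ringMode γ k) := by
  rw [← add_eq_zero_iff_eq_neg, ringMode, ringMode, hγ.sum_smul_anticomm]
  have hr : (r : ℂ) ≠ 0 := by
    have : 0 < r := by omega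
    exact_mod_cast this.ne'
  have hpi : (Real.pi : ℂ) ≠ 0 := by exact_mod_cast Real.pi_ne_zero
  let q := Complex.exp ((k + l + 1) * (2 * Real.pi * Complex.I) / (2 * r))
  have hq : q ^ (2 * r) = 1 := by
    rw [← Complex.exp_nat_mul, Complex.exp_eq_one_iff]
    refine ⟨k + l + 1, ?_⟩
    push_cast
    field_simp
  have hq1 : q ≠ 1 := by
    rw [Ne, Complex.exp_eq_one_iff]
    rintro ⟨p, hp⟩
    have hI := Complex.I_ne_zero
    field_simp at hp
    have h1 : ((k + l + 1 : ℕ) : ℤ) = 2 * r * p := by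
      have : ((k + l + 1 : ℕ) : ℂ) = ((2 * r * p : ℤ) : ℂ) := by
        push_cast
        rw [hp]
      exact_mod_cast this
    have := Int.le_of_dvd (by omega) ⟨p, h1⟩
    omega
  have : ∀ j : Fin (2 * r), Complex.exp (ringMomentum r k * j * Complex.I)
      * Complex.exp (ringMomentum r l * j * Complex.I) = q ^ (j : ℕ) := by
    intro j
    rw [← Complex.exp_add, ← Complex.exp_nat_mul]
    congr 1
    simp only [ringMomentum]
    push_cast
    field_simp
    ring
  simp only [this]
  rw [Fin.sum_univ_eq_sum_range (fun j => q ^ j), geom_sum_eq hq1, hq]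
  simp

/-- A ring of Majorana operators has a state with equal nearest-neighbour correlations. -/
lemma IsMajorana.exists_ring_state {ι : Type*} [Fintype ι] [DecidableEq ι] [Nonempty ι] {r : ℕ}
    (hr : 0 < r) {γ : Fin (2 * r) → Matrix ι ι ℂ} (hγ : IsMajorana γ) :
    ∃ ρ : Matrix ι ι ℂ, ρ.PosSemidef ∧ ρ.trace = 1 ∧ ∀ j l : Fin (2 * r), j.val + 1 = l.val →
      (γ j * γ l * ρ).trace = Complex.I / (r * Real.sin (Real.pi / (2 * r))) := by
  obtain ⟨ψ, hψ, hc⟩ := exists_ne_zero_mulVec_eq_zero (ringMode γ) r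
    fun i hi j hj => hγ.ringMode_anticomm hi hj
  have hN : star ψ ⬝ᵥ ψ ≠ 0 := by simpa using hψ
  refine ⟨(star ψ ⬝ᵥ ψ)⁻¹ • Matrix.vecMulVec ψ (star ψ),
    (Matrix.posSemidef_vecMulVec_self_star ψ).smul (by simp), ?_, fun j l hjl => ?_⟩
  · rw [Matrix.trace_smul, Matrix.trace_vecMulVec, dotProduct_comm ψ, smul_eq_mul,
      inv_mul_cancel₀ hN]
  set G : Fin (2 * r) → ℂ := fun i => star ψ ⬝ᵥ ((γ j * γ i) *ᵥ ψ) with hG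
  have hr' : (r : ℂ) ≠ 0 := by exact_mod_cast hr.ne'
  have h1 : ∀ k < r, ∑ i : Fin (2 * r), Complex.exp (ringMomentum r k * i * Complex.I) * G i = 0 := by
    intro k hk
    have : star ψ ⬝ᵥ (γ j *ᵥ (ringMode γ k *ᵥ ψ)) = 0 := by simp [hc k hk]
    rw [← this, Matrix.mulVec_mulVec]
    simp only [hG, ringMode, Matrix.mul_sum, Matrix.sum_mulVec,
      dotProduct_sum, Matrix.mul_smul, Matrix.smul_mulVec, dotProduct_smul, smul_eq_mul]
  have h2 : ∀ k < r, ∑ i : Fin (2 * r), Complex.exp (-(ringMomentum r k * i * Complex.I)) * G i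
      = 2 * Complex.exp (-(ringMomentum r k * j * Complex.I)) * (star ψ ⬝ᵥ ψ) := by
    intro k hk
    have hanti := hγ.sum_smul_anticomm (Pi.single j 1)
      (fun i => Complex.exp (-(ringMomentum r k * i * Complex.I)))
    have hstar : ∑ i : Fin (2 * r), Complex.exp (-(ringMomentum r k * i * Complex.I)) • γ i
        = (ringMode γ k)ᴴ := by
      simp only [ringMode, Matrix.conjTranspose_sum, Matrix.conjTranspose_smul,
        (hγ.isHermitian _).eq]
      refine Finset.sum_congr rfl fun i _ => ?_
      rw [Complex.star_def, ← Complex.exp_conj]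
      simp
    have h3 : star ψ ⬝ᵥ (((ringMode γ k)ᴴ * γ j) *ᵥ ψ) = 0 := by
      rw [← Matrix.mulVec_mulVec, Matrix.dotProduct_mulVec, ← Matrix.star_mulVec, hc k hk]
      simp
    have hsingle : ∑ i, (Pi.single j (1 : ℂ) : Fin (2 * r) → ℂ) i • γ i = γ j := by
      rw [Finset.sum_eq_single j] <;> simp +contextual
    have hsingle' : ∑ i, (Pi.single j (1 : ℂ) : Fin (2 * r) → ℂ) i
        * Complex.exp (-(ringMomentum r k * i * Complex.I))
        = Complex.exp (-(ringMomentum r k * j * Complex.I)) := by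
      rw [Finset.sum_eq_single j] <;> simp +contextual
    rw [hsingle, hsingle'] at hanti
    have h4 := congrArg (fun M : Matrix ι ι ℂ => star ψ ⬝ᵥ (M *ᵥ ψ)) hanti
    simp only [Matrix.add_mulVec, dotProduct_add, Matrix.smul_mulVec, dotProduct_smul,
      Matrix.one_mulVec, smul_eq_mul] at h4
    rw [← h4]
    nth_rw 2 [hstar]
    rw [h3, add_zero]
    simp only [hG, Matrix.mul_sum, Matrix.sum_mulVec,
      dotProduct_sum, Matrix.mul_smul, Matrix.smul_mulVec, dotProduct_smul, smul_eq_mul]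
  have h5 : 2 * r * G l = 2 * (star ψ ⬝ᵥ ψ) * (Complex.I / Real.sin (Real.pi / (2 * r))) := by
    rw [← sum_exp_ringMomentum hr, Finset.mul_sum]
    calc 2 * r * G l = ∑ i, (if i = l then 2 * (r : ℂ) else 0) * G i := by simp
      _ = ∑ k ∈ Finset.range r, (Complex.exp (-(ringMomentum r k * l * Complex.I)) *
            ∑ i : Fin (2 * r), Complex.exp (ringMomentum r k * i * Complex.I) * G i
          + Complex.exp (ringMomentum r k * l * Complex.I) *
            ∑ i : Fin (2 * r), Complex.exp (-(ringMomentum r k * i * Complex.I)) * G i) := by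
        simp only [← sum_exp_add_exp_ringMomentum hr, Finset.sum_mul, Finset.mul_sum,
          ← Finset.sum_add_distrib]
        rw [Finset.sum_comm]
        refine Finset.sum_congr rfl fun k _ => Finset.sum_congr rfl fun i _ => ?_
        rw [← mul_assoc, ← mul_assoc, ← add_mul, ← Complex.exp_add, ← Complex.exp_add]
        ring_nf
      _ = _ := by
        refine Finset.sum_congr rfl fun k hk => ?_
        rw [h1 k (Finset.mem_range.1 hk), h2 k (Finset.mem_range.1 hk), mul_zero, zero_add]
        have : Complex.exp (ringMomentum r k * Complex.I)
            = Complex.exp (ringMomentum r k * l * Complex.I)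
              * Complex.exp (-(ringMomentum r k * j * Complex.I)) := by
          rw [← Complex.exp_add, show (l : ℂ) = j + 1 by exact_mod_cast hjl.symm]
          ring_nf
        rw [this]
        ring
  rw [Matrix.mul_smul, Matrix.trace_smul, Matrix.mul_vecMulVec, Matrix.trace_vecMulVec,
    dotProduct_comm _ (star ψ), smul_eq_mul, show star ψ ⬝ᵥ ((γ j * γ l) *ᵥ ψ) = G l from rfl,
    show G l = (star ψ ⬝ᵥ ψ) * (Complex.I / Real.sin (Real.pi / (2 * r))) / r by
      field_simp; linear_combination h5 / 2]
  field_simp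

lemma inv_mul_sin_mem_Icc {r : ℕ} (hr : 0 < r) :
    1 / (r * Real.sin (Real.pi / (2 * r))) ∈ Set.Icc (0 : ℝ) 1 := by
  have hr' : (1 : ℝ) ≤ r := by exact_mod_cast hr
  have h := Real.mul_le_sin (x := Real.pi / (2 * r)) (by positivity)
    (div_le_div_of_nonneg_left Real.pi_pos.le two_pos (by linarith))
  have h1 : 1 ≤ r * Real.sin (Real.pi / (2 * r)) := by
    calc (1 : ℝ) = r * (2 / Real.pi * (Real.pi / (2 * r))) := by
          have := Real.pi_ne_zero
          field_simp
      _ ≤ _ := mul_le_mul_of_nonneg_left h (by linarith)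
  exact ⟨by positivity, (div_le_one (by linarith)).2 h1⟩

lemma le_incompatibilityRobustness_pathGraph {n r : ℕ} (hr : 0 < r) (hn : n + 1 ≤ 2 * r) :
    1 / (r * Real.sin (Real.pi / (2 * r)))
      ≤ incompatibilityRobustness (SimpleGraph.pathGraph n) := by
  obtain ⟨d, hd, γ, hγ⟩ := exists_isMajorana (2 * r)
  have : Nonempty (Fin d) := ⟨⟨0, hd⟩⟩
  obtain ⟨ρ, hρ, hρ1, ht⟩ := hγ.exists_ring_state hr
  have hγ' := hγ.comp (Fin.castLE_injective hn)
  have hA := hγ'.realises hd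
  refine (isGreatest_incompatibilityRobustness hd hA).2 ⟨inv_mul_sin_mem_Icc hr, ?_⟩
  refine jointlyMeasurable_of_state hA.isHermitian hA.mul_self hA.isHermitian hA.mul_self
    (fun u v => ?_) hρ hρ1 fun v => ?_
  · by_cases huv : (SimpleGraph.pathGraph n).Adj u v
    · exact Or.inr ⟨(hA.adj_iff u v).1 huv, (hA.adj_iff u v).1 huv⟩
    · exact Or.inl ⟨hA.commute u v huv, hA.commute u v huv⟩
  · rw [neighbourProduct, Matrix.smul_mul, Matrix.trace_smul, Function.comp_apply,
      Function.comp_apply, ht _ _ (by simp), smul_eq_mul]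
    push_cast
    rw [← mul_div_assoc, neg_mul, Complex.I_mul_I, neg_neg]

/-- The momenta of the open chain with `n + 1` sites. -/
noncomputable def chainMomentum (n k : ℕ) : ℝ := (k + 1) * Real.pi / (n + 2)

lemma chainMomentum_reflect {n k : ℕ} (hk : k < n + 1) :
    chainMomentum n (n + 1 - 1 - k) = Real.pi - chainMomentum n k := by
  have : k ≤ n := by omega
  rw [chainMomentum, chainMomentum, Nat.add_sub_cancel, Nat.cast_sub this]
  field_simp
  ring

lemma sum_cos_chainMomentum {n : ℕ} {p : ℤ} (hp : |p| < 2 * (n + 2)) :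
    ∑ k ∈ Finset.range (n + 1), Real.cos (p * chainMomentum n k)
      = (if p = 0 then (n : ℝ) + 2 else 0) - Real.cos (p * Real.pi / 2) ^ 2 := by
  split_ifs with h0
  · subst h0
    simp
    ring
  set x := p * Real.pi / (2 * (n + 2)) with hx
  have hs : Real.sin x ≠ 0 := by
    rw [Ne, Real.sin_eq_zero_iff]
    rintro ⟨q, hq⟩
    have h1 : (q * (2 * (n + 2)) : ℝ) = p := by
      have := Real.pi_ne_zero
      rw [hx] at hq
      field_simp at hq
      linarith
    have h2 : p = 2 * (n + 2) * q := by
      have : q * (2 * (n + 2)) = p := by exact_mod_cast h1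
      linarith
    exact h0 (Int.eq_zero_of_abs_lt_dvd ⟨q, h2⟩ hp)
  have h := Real.sin_mul_sum_cos (n + 1) (p * Real.pi / (n + 2)) (p * Real.pi / (n + 2))
  have e1 : p * Real.pi / (n + 2) / 2 = x := by rw [hx]; field_simp
  have e2 : ((n + 1 : ℕ) : ℝ) * (p * Real.pi / (n + 2)) / 2 = p * Real.pi / 2 - x := by
    rw [hx]
    push_cast
    field_simp
    ring
  have e3 : (((n + 1 : ℕ) : ℝ) - 1) * (p * Real.pi / (n + 2)) / 2 + p * Real.pi / (n + 2)
      = p * Real.pi / 2 := by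
    push_cast
    field_simp
    ring
  have e4 : Real.sin (p * Real.pi / 2) * Real.cos (p * Real.pi / 2) = 0 := by
    have := Real.sin_two_mul (p * Real.pi / 2)
    rw [show 2 * (p * Real.pi / 2) = p * Real.pi by ring, Real.sin_int_mul_pi] at this
    linarith
  rw [e1, e2, e3, Real.sin_sub] at h
  apply mul_left_cancel₀ hs
  have h' : ∀ k : ℕ, Real.cos (p * chainMomentum n k)
      = Real.cos (p * Real.pi / (n + 2) * k + p * Real.pi / (n + 2)) := fun k => by
    rw [chainMomentum]
    congr 1
    ring
  simp only [h']
  rw [h]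
  linear_combination Real.cos x * e4

lemma sum_sin_sq_chainMomentum (n : ℕ) {k : ℕ} (hk : k < n + 1) :
    ∑ j : Fin (n + 1), Real.sin ((j + 1) * chainMomentum n k) ^ 2 = ((n : ℝ) + 2) / 2 := by
  have h := sum_cos_chainMomentum (n := n) (p := 2 * (k + 1)) (by rw [abs_lt]; omega)
  rw [if_neg (by omega)] at h
  have h1 : Real.cos (((2 * (k + 1) : ℤ) : ℝ) * Real.pi / 2) ^ 2 = 1 := by
    rw [show ((2 * (k + 1) : ℤ) : ℝ) * Real.pi / 2 = (k + 1 : ℕ) * Real.pi by push_cast; ring,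
      Real.cos_nat_mul_pi, ← pow_mul, mul_comm, pow_mul]
    simp
  rw [h1] at h
  rw [Fin.sum_univ_eq_sum_range (fun j => Real.sin ((j + 1) * chainMomentum n k) ^ 2)]
  have h2 : ∀ j : ℕ, Real.sin ((j + 1) * chainMomentum n k) ^ 2
      = 1 / 2 - 1 / 2 * Real.cos (((2 * (k + 1) : ℤ) : ℝ) * chainMomentum n j) := by
    intro j
    rw [Real.sin_sq_eq_half_sub, chainMomentum, chainMomentum]
    push_cast
    ring_nf
  simp only [h2, Finset.sum_sub_distrib, ← Finset.mul_sum, h]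
  simp
  ring

lemma sum_cos_mul_sin_mul_sin_chainMomentum (n : ℕ) (j l : Fin (n + 1)) :
    ∑ k ∈ Finset.range (n + 1), Real.cos (chainMomentum n k) *
      (Real.sin ((j + 1) * chainMomentum n k) * Real.sin ((l + 1) * chainMomentum n k))
      = if j.val + 1 = l.val ∨ l.val + 1 = j.val then ((n : ℝ) + 2) / 4 else 0 := by
  have hcos : ∀ p q : ℤ, Even (p - q) →
      Real.cos (p * Real.pi / 2) ^ 2 = Real.cos (q * Real.pi / 2) ^ 2 := by
    rintro p q ⟨m, hm⟩
    rw [Real.cos_sq, Real.cos_sq, show p = q + m + m by omega]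
    congr 2
    rw [show 2 * (((q + m + m : ℤ) : ℝ) * Real.pi / 2)
      = 2 * (q * Real.pi / 2) + m * (2 * Real.pi) by push_cast; ring, Real.cos_add_int_mul_two_pi]
  have key : ∀ k, Real.cos (chainMomentum n k) *
      (Real.sin ((j + 1) * chainMomentum n k) * Real.sin ((l + 1) * chainMomentum n k))
      = 1 / 4 * (Real.cos (((j - l + 1 : ℤ) : ℝ) * chainMomentum n k)
        + Real.cos (((j - l - 1 : ℤ) : ℝ) * chainMomentum n k)
        - Real.cos (((j + l + 3 : ℤ) : ℝ) * chainMomentum n k)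
        - Real.cos (((j + l + 1 : ℤ) : ℝ) * chainMomentum n k)) := by
    intro k
    set x := chainMomentum n k
    have e1 : ((j - l + 1 : ℤ) : ℝ) * x = (j + 1) * x - (l + 1) * x + x := by push_cast; ring
    have e2 : ((j - l - 1 : ℤ) : ℝ) * x = (j + 1) * x - (l + 1) * x - x := by push_cast; ring
    have e3 : ((j + l + 3 : ℤ) : ℝ) * x = (j + 1) * x + (l + 1) * x + x := by push_cast; ring
    have e4 : ((j + l + 1 : ℤ) : ℝ) * x = (j + 1) * x + (l + 1) * x - x := by push_cast; ring
    rw [e1, e2, e3, e4, Real.cos_add _ x, Real.cos_sub _ x, Real.cos_add _ x, Real.cos_sub _ x,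
      Real.cos_sub, Real.cos_add]
    ring
  simp only [key, ← Finset.mul_sum, Finset.sum_sub_distrib, Finset.sum_add_distrib]
  have hj := j.isLt
  have hl := l.isLt
  rw [sum_cos_chainMomentum (by rw [abs_lt]; omega), sum_cos_chainMomentum (by rw [abs_lt]; omega),
    sum_cos_chainMomentum (by rw [abs_lt]; omega), sum_cos_chainMomentum (by rw [abs_lt]; omega),
    if_neg (show (j : ℤ) + l + 3 ≠ 0 by omega), if_neg (show (j : ℤ) + l + 1 ≠ 0 by omega),
    hcos (j + l + 3) (j - l + 1) ⟨l + 1, by ring⟩, hcos (j + l + 1) (j - l + 1) ⟨l, by ring⟩,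
    hcos (j - l - 1) (j - l + 1) ⟨-1, by ring⟩]
  rcases lt_trichotomy (j.val + 1) l.val with h | h | h
  · rw [if_neg (by omega), if_neg (by omega), if_neg (by omega)]; ring
  · rw [if_pos (by omega), if_neg (by omega), if_pos (by omega)]; ring
  · by_cases h' : l.val + 1 = j.val
    · rw [if_neg (by omega), if_pos (by omega), if_pos (by omega)]; ring
    · rw [if_neg (by omega), if_neg (by omega), if_neg (by omega)]; ring

lemma sum_abs_cos_mul_sin_mul_sin_chainMomentum (n : ℕ) {j l : Fin (n + 1)}
    (h : Odd (j.val + l.val)) :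
    ∑ k ∈ Finset.range (n + 1), |Real.cos (chainMomentum n k)| *
      (Real.sin ((j + 1) * chainMomentum n k) * Real.sin ((l + 1) * chainMomentum n k)) = 0 := by
  rw [← self_eq_neg]
  nth_rw 1 [← Finset.sum_range_reflect]
  rw [← Finset.sum_neg_distrib]
  refine Finset.sum_congr rfl fun k hk => ?_
  rw [chainMomentum_reflect (Finset.mem_range.1 hk), Real.cos_pi_sub, abs_neg]
  have hs : ∀ i : ℕ, Real.sin ((i + 1) * (Real.pi - chainMomentum n k))
      = (-1) ^ i * Real.sin ((i + 1) * chainMomentum n k) := by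
    intro i
    have := Real.sin_nat_mul_pi_sub ((i + 1) * chainMomentum n k) (i + 1)
    push_cast at this
    rw [mul_sub, this, pow_succ]
    ring
  rw [hs, hs]
  have : (-1 : ℝ) ^ (j.val + l.val) = -1 := h.neg_one_pow
  rw [pow_add] at this
  linear_combination |Real.cos (chainMomentum n k)| *
    (Real.sin ((j + 1) * chainMomentum n k) * Real.sin ((l + 1) * chainMomentum n k)) * this

lemma Fin.sum_sum_ite_adjacent {M : Type*} [AddCommMonoid M] {n : ℕ}
    (f : Fin (n + 1) → Fin (n + 1) → M) :
    ∑ j, ∑ l, (if j.val + 1 = l.val ∨ l.val + 1 = j.val then f j l else 0)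
      = ∑ v : Fin n, (f v.castSucc v.succ + f v.succ v.castSucc) := by
  have h1 : ∀ f : Fin (n + 1) → Fin (n + 1) → M,
      ∑ j, ∑ l, (if j.val + 1 = l.val then f j l else 0) = ∑ v : Fin n, f v.castSucc v.succ := by
    intro f
    rw [Fin.sum_univ_castSucc]
    have hlast : ∑ l : Fin (n + 1), (if (Fin.last n).val + 1 = l.val then f (Fin.last n) l else 0)
        = 0 := Finset.sum_eq_zero fun l _ => if_neg (by simp; omega)
    rw [hlast, add_zero]
    refine Finset.sum_congr rfl fun v _ => ?_
    rw [Finset.sum_eq_single v.succ]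
    · simp
    · intro l _ hl
      exact if_neg fun h => hl (Fin.ext (by simpa using h.symm))
    · simp
  rw [Finset.sum_add_distrib, ← h1, ← h1 fun j l => f l j]
  rw [Finset.sum_comm (f := fun j l : Fin (n + 1) => if j.val + 1 = l.val then f l j else 0),
    ← Finset.sum_add_distrib]
  refine Finset.sum_congr rfl fun j _ => ?_
  rw [← Finset.sum_add_distrib]
  refine Finset.sum_congr rfl fun l _ => ?_
  by_cases hjl : j.val + 1 = l.val
  · rw [if_pos (Or.inl hjl), if_pos hjl, if_neg (by omega), add_zero]
  · by_cases hlj : l.val + 1 = j.val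
    · rw [if_pos (Or.inr hlj), if_neg hjl, if_pos hlj, zero_add]
    · rw [if_neg (by omega), if_neg hjl, if_neg hlj, zero_add]

/-- The largest eigenvalue of the sum of the nearest-neighbour products on the open chain. -/
noncomputable def chainEnergy (n : ℕ) : ℝ :=
  ∑ k ∈ Finset.range (n + 1), |Real.cos (chainMomentum n k)|

lemma IsMajorana.posSemidef_chainEnergy_sub {ι : Type*} [Fintype ι] [DecidableEq ι] {n : ℕ}
    {γ : Fin (n + 1) → Matrix ι ι ℂ} (hγ : IsMajorana γ) :
    ((chainEnergy n : ℂ) • (1 : Matrix ι ι ℂ) - ∑ v, neighbourProduct γ v).PosSemidef := by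
  let β : Fin (n + 1) → Matrix ι ι ℂ := fun j => Complex.I ^ j.val • γ j
  let T : Fin (n + 1) → Fin (n + 1) → Matrix ι ι ℂ := fun j l => (β j)ᴴ * β l
  let s : ℕ → Fin (n + 1) → ℝ := fun k j => Real.sin ((j + 1) * chainMomentum n k)
  let c : ℕ → ℝ := fun k => Real.cos (chainMomentum n k)
  have hT : ∀ j l, T j l = ((-Complex.I) ^ j.val * Complex.I ^ l.val) • (γ j * γ l) := by
    intro j l
    simp only [T, β, Matrix.conjTranspose_smul, (hγ.isHermitian _).eq, smul_mul_smul_comm]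
    simp
  have hTdiag : ∀ j, T j j = 1 := by
    intro j
    rw [hT, ← mul_pow, hγ.mul_self]
    simp
  have hTanti : ∀ j l, j ≠ l → Even (j.val + l.val) → T j l + T l j = 0 := by
    intro j l hjl heven
    have : (-1 : ℂ) ^ j.val = (-1) ^ l.val := by
      rcases Nat.even_or_odd j.val with hj | hj
      · rw [hj.neg_one_pow, ((Nat.even_add.1 heven).1 hj).neg_one_pow]
      · rw [hj.neg_one_pow, ((Nat.even_add'.1 heven).1 hj).neg_one_pow]
    rw [hT, hT, hγ.anticomm j l hjl, neg_pow, neg_pow Complex.I, this]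
    module
  have hTsucc : ∀ v : Fin n, T v.castSucc v.succ + T v.succ v.castSucc
      = (-2 : ℂ) • neighbourProduct γ v := by
    intro v
    have h1 : (-Complex.I) ^ v.val * Complex.I ^ v.val = 1 := by
      rw [← mul_pow]
      simp
    rw [hT, hT, hγ.anticomm v.succ v.castSucc (Fin.castSucc_lt_succ).ne', neighbourProduct,
      smul_neg, ← sub_eq_add_neg, ← sub_smul, smul_smul]
    congr 1
    simp only [Fin.val_castSucc, Fin.val_succ, pow_succ]
    linear_combination 2 * Complex.I * h1
  have hpos : (∑ k ∈ Finset.range (n + 1), (((|c k| + c k : ℝ)) : ℂ) •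
      ((∑ j, (s k j : ℂ) • β j)ᴴ * ∑ l, (s k l : ℂ) • β l)).PosSemidef := by
    refine Matrix.posSemidef_sum _ fun k _ =>
      (Matrix.posSemidef_conjTranspose_mul_self _).smul ?_
    exact_mod_cast (by linarith [neg_abs_le (c k)] : 0 ≤ |c k| + c k)
  have hexpand : ∑ k ∈ Finset.range (n + 1), (((|c k| + c k : ℝ)) : ℂ) •
      ((∑ j, (s k j : ℂ) • β j)ᴴ * ∑ l, (s k l : ℂ) • β l)
      = ∑ j, ∑ l, ((∑ k ∈ Finset.range (n + 1), |c k| * (s k j * s k l) : ℝ) : ℂ) • T j l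
        + ∑ j, ∑ l, ((∑ k ∈ Finset.range (n + 1), c k * (s k j * s k l) : ℝ) : ℂ) • T j l := by
    simp only [← Finset.sum_add_distrib, ← add_smul, ← Complex.ofReal_add, ← add_mul]
    simp only [Matrix.conjTranspose_sum, Matrix.conjTranspose_smul, Finset.sum_mul_sum,
      smul_mul_smul_comm, Finset.smul_sum, smul_smul, Complex.ofReal_sum, Finset.sum_smul]
    rw [Finset.sum_comm]
    refine Finset.sum_congr rfl fun j _ => ?_
    rw [Finset.sum_comm]
    refine Finset.sum_congr rfl fun l _ => Finset.sum_congr rfl fun k _ => ?_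
    simp [T]
  have hF : ∑ j, ∑ l, ((∑ k ∈ Finset.range (n + 1), |c k| * (s k j * s k l) : ℝ) : ℂ) • T j l
      = ((((n : ℝ) + 2) / 2 * chainEnergy n : ℝ) : ℂ) • (1 : Matrix ι ι ℂ) := by
    set F : Fin (n + 1) → Fin (n + 1) → ℝ :=
      fun j l => ∑ k ∈ Finset.range (n + 1), |c k| * (s k j * s k l) with hFdef
    have hFsymm : ∀ j l, F j l = F l j := fun j l => by simp only [hFdef, mul_comm (s _ j)]
    have hpair : ∀ j l, (F j l : ℂ) • T j l + (F l j : ℂ) • T l j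
        = if j = l then (2 * (F j j : ℂ)) • (1 : Matrix ι ι ℂ) else 0 := by
      intro j l
      split_ifs with hjl
      · rw [← hjl, hTdiag]
        module
      · rcases Nat.even_or_odd (j.val + l.val) with he | ho
        · rw [hFsymm l j, ← smul_add, hTanti j l hjl he, smul_zero]
        · rw [hFsymm l j, show F j l = 0 from sum_abs_cos_mul_sin_mul_sin_chainMomentum n ho]
          simp
    have htwo : (2 : ℂ) • ∑ j, ∑ l, (F j l : ℂ) • T j l
        = (2 : ℂ) • ∑ j, (F j j : ℂ) • (1 : Matrix ι ι ℂ) := by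
      rw [two_smul]
      nth_rw 2 [Finset.sum_comm]
      simp only [← Finset.sum_add_distrib, hpair, Finset.sum_ite_eq, Finset.mem_univ, if_true,
        mul_smul, Finset.smul_sum]
    have htrace : ∑ j, F j j = ((n : ℝ) + 2) / 2 * chainEnergy n := by
      simp only [hFdef, ← sq]
      rw [Finset.sum_comm, chainEnergy, Finset.mul_sum]
      refine Finset.sum_congr rfl fun k hk => ?_
      rw [← Finset.mul_sum, sum_sin_sq_chainMomentum n (Finset.mem_range.1 hk), mul_comm]
    rw [smul_right_injective _ (two_ne_zero (α := ℂ)) htwo, ← Finset.sum_smul,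
      ← Complex.ofReal_sum, htrace]
  have hD : ∑ j, ∑ l, ((∑ k ∈ Finset.range (n + 1), c k * (s k j * s k l) : ℝ) : ℂ) • T j l
      = -((((n : ℝ) + 2) / 2 : ℝ) : ℂ) • ∑ v, neighbourProduct γ v := by
    have : ∀ j l, ((∑ k ∈ Finset.range (n + 1), c k * (s k j * s k l) : ℝ) : ℂ) • T j l
        = if j.val + 1 = l.val ∨ l.val + 1 = j.val then ((((n : ℝ) + 2) / 4 : ℝ) : ℂ) • T j l
          else 0 := by
      intro j l
      simp only [c, s, sum_cos_mul_sin_mul_sin_chainMomentum]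
      split_ifs <;> simp
    simp only [this]
    rw [Fin.sum_sum_ite_adjacent, Finset.smul_sum]
    refine Finset.sum_congr rfl fun v _ => ?_
    rw [← smul_add, hTsucc, smul_smul]
    congr 1
    push_cast
    ring
  rw [hexpand, hF, hD] at hpos
  have hn : (0 : ℂ) ≤ ((2 / ((n : ℝ) + 2) : ℝ) : ℂ) := by
    exact_mod_cast (by positivity : 0 ≤ 2 / ((n : ℝ) + 2))
  have hn' : (n : ℂ) + 2 ≠ 0 := by exact_mod_cast (by omega : n + 2 ≠ 0)
  convert hpos.smul hn using 1
  rw [smul_add, smul_smul, smul_smul, sub_eq_add_neg, ← neg_one_smul ℂ (∑ v, _)]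
  congr 2 <;> push_cast <;> field_simp

lemma Matrix.PosSemidef.trace_mul_nonneg {ι : Type*} [Fintype ι] {M N : Matrix ι ι ℂ}
    (hM : M.PosSemidef) (hN : N.PosSemidef) : 0 ≤ (M * N).trace := by
  obtain ⟨m, w, rfl⟩ := Matrix.posSemidef_iff_eq_sum_vecMulVec.1 hM
  rw [Matrix.sum_mul, Matrix.trace_sum]
  refine Finset.sum_nonneg fun i _ => ?_
  rw [Matrix.trace_mul_comm, Matrix.mul_vecMulVec, Matrix.trace_vecMulVec, dotProduct_comm]
  exact hN.dotProduct_mulVec_nonneg _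

lemma IsMajorana.posSemidef_chainEnergy_sub_signed {ι : Type*} [Fintype ι] [DecidableEq ι] {n : ℕ}
    {γ : Fin (n + 1) → Matrix ι ι ℂ} (hγ : IsMajorana γ) (a : Fin n → ℤˣ) :
    ((chainEnergy n : ℂ) • (1 : Matrix ι ι ℂ)
      - ∑ v, (((a v : ℤˣ) : ℤ) : ℂ) • neighbourProduct γ v).PosSemidef := by
  let σ : Fin (n + 1) → ℂ := fun j => ((Fin.partialProd a j : ℤˣ) : ℤ)
  have hσ : ∀ j, σ j = 1 ∨ σ j = -1 := fun j => by
    rcases Int.units_eq_one_or (Fin.partialProd a j) with h | h <;> simp [σ, h]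
  have hσσ : ∀ j, σ j * σ j = 1 := fun j => by rcases hσ j with h | h <;> simp [h]
  have hγ' : IsMajorana fun j => σ j • γ j := by
    refine ⟨fun j => ?_, fun j => ?_, fun i j hij => ?_⟩
    · rw [Matrix.IsHermitian, Matrix.conjTranspose_smul, (hγ.isHermitian j).eq]
      rcases hσ j with h | h <;> simp [h]
    · rw [smul_mul_smul_comm, hγ.mul_self, hσσ, one_smul]
    · rw [smul_mul_smul_comm, smul_mul_smul_comm, hγ.anticomm i j hij, smul_neg, mul_comm]
  have h : ∀ v, neighbourProduct (fun j => σ j • γ j) v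
      = (((a v : ℤˣ) : ℤ) : ℂ) • neighbourProduct γ v := by
    intro v
    have : σ v.succ = σ v.castSucc * (((a v : ℤˣ) : ℤ) : ℂ) := by
      simp [σ, Fin.partialProd_succ]
    rw [neighbourProduct, smul_mul_smul_comm, this, ← mul_assoc, hσσ, one_mul, smul_comm,
      neighbourProduct]
  simpa only [h] using hγ'.posSemidef_chainEnergy_sub

lemma incompatibilityRobustness_pathGraph_le (n : ℕ) :
    n * incompatibilityRobustness (SimpleGraph.pathGraph n) ≤ chainEnergy n := by
  obtain ⟨d, hd, γ, hγ⟩ := exists_isMajorana (n + 1)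
  have hA := hγ.realises hd
  obtain ⟨-, h⟩ := (isGreatest_incompatibilityRobustness hd hA).1
  set t := incompatibilityRobustness (SimpleGraph.pathGraph n)
  obtain ⟨E, hE, hEA⟩ := (jointlyMeasurable_iff _ _).1 h
  have hnonneg : 0 ≤ ∑ a, (E a * ((chainEnergy n : ℂ) • (1 : Matrix (Fin d) (Fin d) ℂ)
      - ∑ v, (((a v : ℤˣ) : ℤ) : ℂ) • neighbourProduct γ v)).trace :=
    Finset.sum_nonneg fun a _ =>
      (hE.posSemidef a).trace_mul_nonneg (hγ.posSemidef_chainEnergy_sub_signed a)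
  have heq : ∑ a, (E a * ((chainEnergy n : ℂ) • (1 : Matrix (Fin d) (Fin d) ℂ)
      - ∑ v, (((a v : ℤˣ) : ℤ) : ℂ) • neighbourProduct γ v))
      = ((chainEnergy n - n * t : ℝ) : ℂ) • (1 : Matrix (Fin d) (Fin d) ℂ) := by
    simp only [mul_sub, Matrix.mul_smul, mul_one, Finset.mul_sum, Finset.sum_sub_distrib,
      ← Finset.smul_sum, hE.sum_eq_one]
    rw [Finset.sum_comm]
    have : ∀ v, ∑ a, (((a v : ℤˣ) : ℤ) : ℂ) • (E a * neighbourProduct γ v)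
        = (t : ℂ) • (1 : Matrix (Fin d) (Fin d) ℂ) := by
      intro v
      simp only [← Matrix.smul_mul, ← Matrix.sum_mul, hEA]
      rw [Matrix.smul_mul, hA.mul_self]
    simp only [this, Finset.sum_const, Finset.card_univ, Fintype.card_fin]
    push_cast
    module
  rw [← Matrix.trace_sum, heq, Matrix.trace_smul, Matrix.trace_one, Fintype.card_fin,
    smul_eq_mul] at hnonneg
  have h' : 0 ≤ (chainEnergy n - n * t) * (d : ℝ) := by exact_mod_cast hnonneg
  have hd' : (0 : ℝ) < d := by exact_mod_cast hd
  linarith [nonneg_of_mul_nonneg_left h' hd']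

lemma chainEnergy_eq_sum {n r : ℕ} (h : n + 1 = 2 * r ∨ n = 2 * r) :
    chainEnergy n = 2 * ∑ k ∈ Finset.range r, Real.cos (chainMomentum n k) := by
  have hlow : ∑ k ∈ Finset.range r, |Real.cos (chainMomentum n k)|
      = ∑ k ∈ Finset.range r, Real.cos (chainMomentum n k) := by
    refine Finset.sum_congr rfl fun k hk => abs_of_nonneg ?_
    have hk' : (k : ℝ) + 1 ≤ r := by exact_mod_cast Finset.mem_range.1 hk
    have hr : 2 * (r : ℝ) ≤ n + 2 := by exact_mod_cast (by omega : 2 * r ≤ n + 2)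
    refine Real.cos_nonneg_of_neg_pi_div_two_le_of_le ?_ ?_
    · have : 0 ≤ chainMomentum n k := by rw [chainMomentum]; positivity
      linarith [Real.pi_pos]
    · rw [chainMomentum, div_le_div_iff₀ (by positivity) two_pos]
      nlinarith [Real.pi_pos]
  have hhigh : ∀ e, n + 1 = r + e + r → ∑ k ∈ Finset.range r, |Real.cos (chainMomentum n (r + e + k))|
      = ∑ k ∈ Finset.range r, |Real.cos (chainMomentum n k)| := by
    intro e he
    rw [← Finset.sum_range_reflect]
    refine Finset.sum_congr rfl fun k hk => ?_
    have hk' := Finset.mem_range.1 hk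
    rw [show r + e + (r - 1 - k) = n + 1 - 1 - k by omega, chainMomentum_reflect (by omega),
      Real.cos_pi_sub, abs_neg]
  rw [chainEnergy, ← hlow, two_mul]
  rcases h with h | h
  · rw [show n + 1 = r + 0 + r by omega, Finset.sum_range_add, hhigh 0 (by omega), add_zero]
  · have hmid : Real.cos (chainMomentum n r) = 0 := by
      rw [← Real.cos_pi_div_two]
      congr 1
      rw [chainMomentum, h]
      push_cast
      field_simp
    rw [show n + 1 = r + 1 + r by omega, Finset.sum_range_add, hhigh 1 (by omega),
      Finset.sum_range_succ, hmid, abs_zero, add_zero]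

lemma sin_pi_div_two_mul_pos {x : ℝ} (hx : 1 ≤ x) : 0 < Real.sin (Real.pi / (2 * x)) :=
  Real.sin_pos_of_pos_of_lt_pi (by positivity) (div_lt_self Real.pi_pos (by linarith))

lemma chainEnergy_eq {n r : ℕ} (h : n + 1 = 2 * r ∨ n = 2 * r) :
    chainEnergy n = Real.sin ((2 * r + 1) * (Real.pi / (2 * (n + 2))))
      / Real.sin (Real.pi / (2 * ((n : ℝ) + 2))) - 1 := by
  have hs := sin_pi_div_two_mul_pos (x := (n : ℝ) + 2) (by linarith [Nat.cast_nonneg (α := ℝ) n])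
  have h1 := Real.sin_mul_sum_cos r (Real.pi / (n + 2)) (Real.pi / (n + 2))
  set y := Real.pi / (2 * ((n : ℝ) + 2)) with hy
  have hy2 : Real.pi / ((n : ℝ) + 2) = 2 * y := by
    rw [hy]
    field_simp
  rw [hy2] at h1
  have h2 : ∀ k, Real.cos (chainMomentum n k) = Real.cos (2 * y * k + 2 * y) := by
    intro k
    rw [← hy2, chainMomentum]
    congr 1
    ring
  have h3 := Real.sin_sub_sin ((2 * r + 1) * y) y
  rw [chainEnergy_eq_sum h, eq_sub_iff_add_eq, eq_div_iff hs.ne']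
  simp only [h2]
  rw [show 2 * y / 2 = y by ring, show (r : ℝ) * (2 * y) / 2 = ((2 * r + 1) * y - y) / 2 by ring,
    show ((r : ℝ) - 1) * (2 * y) / 2 + 2 * y = ((2 * r + 1) * y + y) / 2 by ring] at h1
  linear_combination 2 * h1 - h3

lemma incompatibilityRobustness_pathGraph_le_of_chainEnergy {n : ℕ} (hn : 1 ≤ n) {x : ℝ}
    (h : chainEnergy n = x - 1) :
    incompatibilityRobustness (SimpleGraph.pathGraph n) ≤ 1 / (n : ℝ) * x - 1 / (n : ℝ) := by
  have hn' : (0 : ℝ) < n := by exact_mod_cast hn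
  have := incompatibilityRobustness_pathGraph_le n
  rw [show 1 / (n : ℝ) * x - 1 / (n : ℝ) = (x - 1) / n by ring, le_div_iff₀ hn', ← h]
  linarith

lemma tendsto_one_div_mul_sin :
    Filter.Tendsto (fun r : ℕ => 1 / (r * Real.sin (Real.pi / (2 * r)))) Filter.atTop
      (nhds (2 / Real.pi)) := by
  have h0 : Filter.Tendsto (fun r : ℕ => Real.pi / 2 / (r : ℝ)) Filter.atTop (nhds 0) :=
    tendsto_const_div_atTop_nhds_zero_nat _
  have h1 := (Real.continuous_sinc.tendsto 0).comp h0
  rw [Real.sinc_zero] at h1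
  have h2 := ((h1.const_mul (Real.pi / 2)).inv₀ (by simp [Real.pi_ne_zero]))
  rw [mul_one, inv_div] at h2
  refine h2.congr' ?_
  filter_upwards [Filter.eventually_ge_atTop 1] with r hr
  have hr' : (r : ℝ) ≠ 0 := by positivity
  have hpi := Real.pi_ne_zero
  rw [Function.comp_apply, Real.sinc_of_ne_zero (by positivity), one_div, div_div]
  congr 1
  field_simp

lemma tendsto_incompatibilityRobustness_pathGraph :
    Filter.Tendsto (fun n : ℕ => incompatibilityRobustness (SimpleGraph.pathGraph n))
      Filter.atTop (nhds (2 / Real.pi)) := by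
  have hlow : Filter.Tendsto (fun n : ℕ => n / 2 + 1) Filter.atTop Filter.atTop :=
    Filter.tendsto_atTop_mono (fun n => (by omega : n / 2 ≤ n / 2 + 1))
      (Nat.tendsto_div_const_atTop two_ne_zero)
  have hratio : Filter.Tendsto (fun n : ℕ => 1 + 2 / (n : ℝ)) Filter.atTop (nhds 1) := by
    simpa using (tendsto_const_div_atTop_nhds_zero_nat 2).const_add (1 : ℝ)
  have hup := hratio.mul (tendsto_one_div_mul_sin.comp (Filter.tendsto_add_atTop_nat 2))
  rw [one_mul] at hup
  refine tendsto_of_tendsto_of_tendsto_of_le_of_le' (tendsto_one_div_mul_sin.comp hlow) hup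
    (Filter.Eventually.of_forall fun n =>
      le_incompatibilityRobustness_pathGraph (r := n / 2 + 1) (Nat.succ_pos _) (by omega)) ?_
  filter_upwards [Filter.eventually_ge_atTop 1] with n hn
  have hn' : (0 : ℝ) < n := by exact_mod_cast hn
  have hs := sin_pi_div_two_mul_pos (x := (n : ℝ) + 2) (by linarith)
  have hE : chainEnergy n ≤ 1 / Real.sin (Real.pi / (2 * ((n : ℝ) + 2))) := by
    obtain ⟨r, hr⟩ : ∃ r, n + 1 = 2 * r ∨ n = 2 * r := ⟨(n + 1) / 2, by omega⟩
    rw [chainEnergy_eq hr]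
    have := div_le_div_of_nonneg_right
      (Real.sin_le_one ((2 * r + 1) * (Real.pi / (2 * ((n : ℝ) + 2))))) hs.le
    linarith
  have h : incompatibilityRobustness (SimpleGraph.pathGraph n)
      ≤ 1 / Real.sin (Real.pi / (2 * ((n : ℝ) + 2))) / n := by
    rw [le_div_iff₀ hn']
    linarith [incompatibilityRobustness_pathGraph_le n]
  refine h.trans (le_of_eq ?_)
  rw [Function.comp_apply]
  push_cast
  field_simp

theorem mainTheorem11 :
    -- the robustness of a path is realised by, and does not depend on, the choice of observables
    (∀ n : ℕ, 1 ≤ n →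
      (∃ d : ℕ, 0 < d ∧ ∃ A : Fin n → Matrix (Fin d) (Fin d) ℂ,
        Realises (SimpleGraph.pathGraph n) A) ∧
      ∀ d : ℕ, 0 < d → ∀ A : Fin n → Matrix (Fin d) (Fin d) ℂ,
        Realises (SimpleGraph.pathGraph n) A →
          IsGreatest (jointSharpness A)
            (incompatibilityRobustness (SimpleGraph.pathGraph n))) ∧
    (∀ n : ℕ, 1 ≤ n → Even n →
      2 / ((n : ℝ) + 2) * (1 / Real.sin (Real.pi / ((n : ℝ) + 2)))
          ≤ incompatibilityRobustness (SimpleGraph.pathGraph n) ∧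
      incompatibilityRobustness (SimpleGraph.pathGraph n)
          ≤ 1 / (n : ℝ) * Real.cot (Real.pi / (2 * ((n : ℝ) + 2))) - 1 / (n : ℝ)) ∧
    (∀ n : ℕ, 1 ≤ n → Odd n →
      2 / ((n : ℝ) + 1) * (1 / Real.sin (Real.pi / ((n : ℝ) + 1)))
          ≤ incompatibilityRobustness (SimpleGraph.pathGraph n) ∧
      incompatibilityRobustness (SimpleGraph.pathGraph n)
          ≤ 1 / (n : ℝ) * (1 / Real.sin (Real.pi / (2 * ((n : ℝ) + 2)))) - 1 / (n : ℝ)) ∧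
    Filter.Tendsto (fun n : ℕ => incompatibilityRobustness (SimpleGraph.pathGraph n))
      Filter.atTop (nhds (2 / Real.pi)) := by
  refine ⟨fun n _ => ⟨exists_realises_pathGraph n, fun d hd A hA =>
    isGreatest_incompatibilityRobustness hd hA⟩, fun n hn heven => ⟨?_, ?_⟩,
    fun n hn hodd => ⟨?_, ?_⟩, tendsto_incompatibilityRobustness_pathGraph⟩
  · obtain ⟨r, hr⟩ := heven.exists_two_nsmul
    rw [smul_eq_mul] at hr
    convert le_incompatibilityRobustness_pathGraph (n := n) (Nat.succ_pos r) (by omega) using 1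
    rw [show (n : ℝ) + 2 = 2 * (r.succ : ℕ) by rw [hr]; push_cast; ring]
    field_simp
  · obtain ⟨r, hr⟩ := heven.exists_two_nsmul
    rw [smul_eq_mul] at hr
    refine incompatibilityRobustness_pathGraph_le_of_chainEnergy hn ?_
    rw [chainEnergy_eq (Or.inr hr), Real.cot_eq_cos_div_sin, ← Real.sin_pi_div_two_sub]
    congr 3
    rw [show (n : ℝ) = 2 * r by exact_mod_cast hr]
    field_simp
    ring
  · obtain ⟨r, hr⟩ := hodd
    convert le_incompatibilityRobustness_pathGraph (n := n) (Nat.succ_pos r) (by omega) using 1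
    rw [show (n : ℝ) + 1 = 2 * (r.succ : ℕ) by rw [hr]; push_cast; ring]
    field_simp
  · obtain ⟨r, hr⟩ := hodd
    refine incompatibilityRobustness_pathGraph_le_of_chainEnergy hn ?_
    have hangle : (2 * ((r + 1 : ℕ) : ℝ) + 1) * (Real.pi / (2 * ((n : ℝ) + 2))) = Real.pi / 2 := by
      rw [show (n : ℝ) = 2 * r + 1 by exact_mod_cast hr]
      push_cast
      field_simp
      ring
    rw [chainEnergy_eq (r := r + 1) (Or.inl (by omega)), hangle, Real.sin_pi_div_two]
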